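/- For a finite-dimensional complex Hilbert space $\mathcal{H}$ let $\mathcal{S}(\mathcal{H})$ be the set of its density operators; a quantum operation is a completely positive trace-preserving map. Let $\mathcal{H}\neq 0$ and $\mathcal{H}_1,\dots,\mathcal{H}_n$ be finite-dimensional complex Hilbert spaces, $N=\{1,\dots,n\}$, $\mathcal{H}_X=\bigotimes_{i\in X}\mathcal{H}_i$ for $X\subseteq N$, let $W_N:\mathcal{S}(\mathcal{H})\to\mathcal{S}(\mathcal{H}_N)$ be a quantum operation, and put $W_X=\mathrm{Tr}_{N\setminus X}\circ W_N$. A set $X\subseteq N$ is called qualified if there is a quantum operation $R$ with $R(W_X(\rho))=\rho$ for all $\rho\in\mathcal{S}(\mathcal{H})$, and forbidden if there is a density operator $\rho_0\in\mathcal{S}(\mathcal{H}_X)$ with $W_X(\rho)=\rho_0$ for all $\rho\in\mathcal{S}(\mathcal{H})$. For integers $k\ge 0$ and $L\ge 1$, $W_N$ is called a $(k,L,n)$-threshold ramp quantum secret sharing scheme if $N$ is qualified and, for every $X\subseteq N$, $X$ is forbidden if and only if $|X|\le k-L$, and $X$ is qualified if and only if $|X|\ge k$. **Corollary.** For every $(k,L,n)$-threshold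 ramp quantum secret sharing scheme, $$\frac1L\log\dim\mathcal{H}\;\le\;\frac1n\sum_{i=1}^n\log\dim\mathcal{H}_i .$$ -/

import Mathlib

noncomputable section

open scoped Matrix.Norms.L2Operator MatrixOrder ComplexOrder

/-- A quantum operation from the operators on `ℂ^d` to the operators on `ℂ^e`: a completely positive
and trace preserving linear map. Operators are written as matrices in the standard orthonormal
bases, which are indexed by the finite types `d` and `e`. -/
structure QuantumOperation (d e : Type*) [Fintype d] [DecidableEq d] [Fintype e] [DecidableEq e]
    extends CompletelyPositiveMap (Matrix d d ℂ) (Matrix e e ℂ) where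
  trace_map' : ∀ A : Matrix d d ℂ, (toLinearMap A).trace = A.trace

/-- The density operators on `ℂ^d`: positive semidefinite of trace one. -/
def densityOperators (d : Type*) [Fintype d] : Set (Matrix d d ℂ) :=
  {ρ | ρ.PosSemidef ∧ ρ.trace = 1}

/-- `E` is reversible with respect to the set `S` of density operators: some quantum operation
undoes `E` on every element of `S`. -/
def IsReversible {d e : Type*} [Fintype d] [DecidableEq d] [Fintype e] [DecidableEq e]
    (E : Matrix d d ℂ →ₗ[ℂ] Matrix e e ℂ) (S : Set (Matrix d d ℂ)) : Prop :=
  ∃ R : QuantumOperation e d, ∀ ρ ∈ S, R.toLinearMap (E ρ) = ρ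

/-- `E` is vanishing with respect to the set `S` of density operators: it maps all elements of `S`
to one and the same density operator. -/
def IsVanishing {d e : Type*} [Fintype d] [Fintype e]
    (E : Matrix d d ℂ →ₗ[ℂ] Matrix e e ℂ) (S : Set (Matrix d d ℂ)) : Prop :=
  ∃ ρ₀ ∈ densityOperators e, ∀ ρ ∈ S, E ρ = ρ₀

/-- The partial trace over the complement of `X`, from the operators on the tensor product of all
the spaces `ℂ^(ι i)` to the operators on the tensor product of those with `i ∈ X`. The product basis
of the tensor product over a set of indices consists of the choice functions on that set. -/
def partialTraceCompl {n : ℕ} {ι : Fin n → Type*} [∀ i, Fintype (ι i)] (X : Finset (Fin n)) :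
    Matrix (∀ i, ι i) (∀ i, ι i) ℂ →ₗ[ℂ]
      Matrix (∀ i : {i // i ∈ X}, ι i) (∀ i : {i // i ∈ X}, ι i) ℂ where
  toFun A := Matrix.of fun x x' =>
    ∑ z : (∀ i : {i // i ∉ X}, ι i),
      A ((Equiv.piEquivPiSubtypeProd (fun i => i ∈ X) ι).symm (x, z))
        ((Equiv.piEquivPiSubtypeProd (fun i => i ∈ X) ι).symm (x', z))
  map_add' A B := by
    ext x x'
    simp [Finset.sum_add_distrib]
  map_smul' c A := by
    ext x x'
    simp [Finset.mul_sum]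

namespace QuantumOperation

variable {n : ℕ} {d : Type*} [Fintype d] [DecidableEq d]
  {ι : Fin n → Type*} [∀ i, Fintype (ι i)] [∀ i, DecidableEq (ι i)]

/-- The encoder `W` followed by the partial trace over the shares outside `X`. -/
def onShares (W : QuantumOperation d (∀ i, ι i)) (X : Finset (Fin n)) :
    Matrix d d ℂ →ₗ[ℂ] Matrix (∀ i : {i // i ∈ X}, ι i) (∀ i : {i // i ∈ X}, ι i) ℂ :=
  partialTraceCompl X ∘ₗ W.toLinearMap

/-- `W` is a quantum secret sharing scheme: it is reversible with respect to all states. -/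
def IsQSSScheme (W : QuantumOperation d (∀ i, ι i)) : Prop :=
  IsReversible W.toLinearMap (densityOperators d)

/-- The set `X` of shares is qualified. -/
def IsQualified (W : QuantumOperation d (∀ i, ι i)) (X : Finset (Fin n)) : Prop :=
  IsReversible (W.onShares X) (densityOperators d)

/-- The set `X` of shares is forbidden. -/
def IsForbidden (W : QuantumOperation d (∀ i, ι i)) (X : Finset (Fin n)) : Prop :=
  IsVanishing (W.onShares X) (densityOperators d)

/-- `W` is a `(k, L, n)`-threshold ramp quantum secret sharing scheme. The difference `k - L` is
taken in the integers. -/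
structure IsThresholdRampScheme (W : QuantumOperation d (∀ i, ι i)) (k L : ℕ) : Prop where
  isQSSScheme : W.IsQSSScheme
  isForbidden_iff : ∀ X : Finset (Fin n), W.IsForbidden X ↔ (X.card : ℤ) ≤ (k : ℤ) - (L : ℤ)
  isQualified_iff : ∀ X : Finset (Fin n), W.IsQualified X ↔ k ≤ X.card

end QuantumOperation

end

open scoped Matrix.Norms.L2Operator MatrixOrder ComplexOrder

/-! Let `X` be forbidden and `X ∪ Y` qualified. A Kraus family of the encoder is a pure tensor with
legs R (a reference for the secret), A = `X`, B = `Y` and G = the remaining shares with the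
environment. Forbiddenness decouples R from A; qualification decouples R from G
(`IsReversible.exists_environment`). Rank plays the role of entropy: |R| rk A ≤ rk RA = rk BG ≤ |B|
rk G, and symmetrically |R| rk G ≤ |B| rk A, whence |R| ≤ |B| (`card_le_card_of_decoupled`).

In a ramp scheme any `L` shares can serve as `Y`, so their joint dimension bounds that of the
secret. Averaging the logarithms over the cyclic windows of length `L` gives the claim. -/

/-! ### Rank inequalities for tensors -/

/-- A tensor whose contraction over its last index is the product of an identity on the first index
and a matrix on the second one has rank at least the product of the two ranks, the second being read
off the tensor with its second index as rows. -/
theorem card_mul_rank_le_rank_of_decoupled {R F C : Type*} [Fintype R] [DecidableEq R] [Nonempty R]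
    [Fintype F] [Fintype C] (T : R → F → C → ℂ) (lam : Matrix F F ℂ)
    (h : ∀ r r' f f', ∑ c, T r f c * star (T r' f' c) = if r = r' then lam f f' else 0) :
    Fintype.card R * (Matrix.of fun f (p : R × C) => T p.1 f p.2).rank ≤
      (Matrix.of fun (p : R × F) c => T p.1 p.2 c).rank := by
  classical
  have hmarg : (Matrix.of fun f (p : R × C) => T p.1 f p.2).rank = lam.rank := by
    rw [← Matrix.rank_self_mul_conjTranspose]
    have : (Matrix.of fun f (p : R × C) => T p.1 f p.2) *
        (Matrix.of fun f (p : R × C) => T p.1 f p.2).conjTranspose =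
        (Fintype.card R : ℂ) • lam := by
      ext f f'
      simp only [Matrix.mul_apply, Matrix.conjTranspose_apply, Matrix.of_apply,
        Fintype.sum_prod_type, h]
      simp
    rw [this]
    exact Matrix.rank_smul_of_mem_nonZeroDivisors _ (by simp)
  rw [hmarg, ← Matrix.rank_self_mul_conjTranspose (Matrix.of fun (p : R × F) c => T p.1 p.2 c)]
  set M := (Matrix.of fun (p : R × F) c => T p.1 p.2 c) *
    (Matrix.of fun (p : R × F) c => T p.1 p.2 c).conjTranspose
  have hM : ∀ (v : R → F → ℂ) r f, M.mulVec (fun p => v p.1 p.2) (r, f) = lam.mulVec (v r) f := by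
    intro v r f
    have hMe : ∀ p q, M p q = if p.1 = q.1 then lam p.2 q.2 else 0 := by
      intro p q
      simp only [M, Matrix.mul_apply, Matrix.conjTranspose_apply, Matrix.of_apply, h]
    simp [Matrix.mulVec, dotProduct, hMe, Fintype.sum_prod_type, ite_mul]
  -- `M` acts as 1 ⊗ `lam`, so one copy of the range of `lam` per value of `R` embeds in its range.
  let Φ : (R → LinearMap.range lam.mulVecLin) →ₗ[ℂ] LinearMap.range M.mulVecLin :=
    { toFun := fun v => ⟨fun p => (v p.1 : F → ℂ) p.2, by
        choose w hw using fun r => (v r).2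
        refine ⟨fun p => w p.1 p.2, ?_⟩
        ext ⟨r, f⟩
        rw [Matrix.mulVecLin_apply, hM, ← hw r, Matrix.mulVecLin_apply]⟩
      map_add' := fun _ _ => rfl
      map_smul' := fun _ _ => rfl }
  have hΦ : Function.Injective Φ := by
    intro v w hvw
    ext r f
    exact congrFun (congrArg Subtype.val hvw) (r, f)
  have := LinearMap.finrank_le_finrank_of_injective hΦ
  rwa [Module.finrank_pi_fintype, Finset.sum_const, smul_eq_mul, Finset.card_univ] at this

/-- Moving an index from the columns to the rows of a tensor multiplies its rank at most by the
number of values of that index. -/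
theorem rank_le_card_mul_rank {A B C : Type*} [Fintype A] [Fintype B] [Fintype C]
    (T : A → B → C → ℂ) :
    (Matrix.of fun (p : A × B) c => T p.1 p.2 c).rank ≤
      Fintype.card B * (Matrix.of fun a (p : B × C) => T a p.1 p.2).rank := by
  classical
  set M := Matrix.of fun (p : A × B) c => T p.1 p.2 c
  set N := Matrix.of fun a (p : B × C) => T a p.1 p.2
  let Φ : LinearMap.range M.mulVecLin →ₗ[ℂ] (B → LinearMap.range N.mulVecLin) :=
    { toFun := fun v b => ⟨fun a => v.1 (a, b), by
        obtain ⟨w, hw⟩ := v.2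
        -- The slice at `b` of `M w` is `N` applied to `w` placed in block `b`.
        refine ⟨fun p => if p.1 = b then w p.2 else 0, ?_⟩
        ext a
        rw [← hw]
        simp only [M, N, Matrix.mulVecLin_apply, Matrix.mulVec, dotProduct, Matrix.of_apply,
          Fintype.sum_prod_type]
        rw [Finset.sum_eq_single b]
        · simp
        · intro b' _ hb
          simp [hb]
        · simp⟩
      map_add' := fun _ _ => rfl
      map_smul' := fun _ _ => rfl }
  have hΦ : Function.Injective Φ := by
    intro v w hvw
    ext ⟨a, b⟩
    exact congrFun (congrArg Subtype.val (congrFun hvw b)) a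
  have := LinearMap.finrank_le_finrank_of_injective hΦ
  rwa [Module.finrank_pi_fintype, Finset.sum_const, smul_eq_mul, Finset.card_univ] at this

/-- If the first index of a pure state is maximally mixed and decoupled both from `A` and from `G`,
then its dimension is at most that of the remaining index `B`. -/
theorem card_le_card_of_decoupled {R A B G : Type*} [Fintype R] [DecidableEq R] [Nonempty R]
    [Fintype A] [Fintype B] [Fintype G] (T : R → A → B → G → ℂ)
    (rho : Matrix A A ℂ) (lam : Matrix G G ℂ)
    (hA : ∀ r r' a a', ∑ b, ∑ g, T r a b g * star (T r' a' b g) = if r = r' then rho a a' else 0)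
    (hG : ∀ r r' g g', ∑ a, ∑ b, T r a b g * star (T r' a b g') = if r = r' then lam g g' else 0)
    (hT : ∃ r a b g, T r a b g ≠ 0) : Fintype.card R ≤ Fintype.card B := by
  have hA₁ := card_mul_rank_le_rank_of_decoupled (fun r a (p : B × G) => T r a p.1 p.2) rho
    (fun r r' a a' => by rw [Fintype.sum_prod_type]; exact hA r r' a a')
  have hG₁ := card_mul_rank_le_rank_of_decoupled (fun r g (p : A × B) => T r p.1 p.2 g) lam
    (fun r r' g g' => by rw [Fintype.sum_prod_type]; exact hG r r' g g')
  have hA₂ := rank_le_card_mul_rank (fun g b (p : R × A) => T p.1 p.2 b g)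
  have hG₂ := rank_le_card_mul_rank (fun a b (p : R × G) => T p.1 a b p.2)
  set rA := (Matrix.of fun a (p : R × B × G) => T p.1 a p.2.1 p.2.2).rank with hrA
  set rG := (Matrix.of fun g (p : R × A × B) => T p.1 p.2.1 p.2.2 g).rank with hrG
  have e₁ : (Matrix.of fun (p : R × A) (c : B × G) => T p.1 p.2 c.1 c.2).rank =
      (Matrix.of fun (p : G × B) (c : R × A) => T c.1 c.2 p.2 p.1).rank := by
    rw [← Matrix.rank_transpose]
    exact (Matrix.rank_submatrix _ (Equiv.prodComm G B) (Equiv.refl (R × A))).symm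
  have e₂ : (Matrix.of fun (p : R × G) (c : A × B) => T p.1 c.1 c.2 p.2).rank =
      (Matrix.of fun (p : A × B) (c : R × G) => T c.1 p.1 p.2 c.2).rank := by
    rw [← Matrix.rank_transpose]
    rfl
  have e₃ : (Matrix.of fun g (p : B × R × A) => T p.2.1 p.2.2 p.1 g).rank = rG :=
    Matrix.rank_submatrix (Matrix.of fun g (p : R × A × B) => T p.1 p.2.1 p.2.2 g) (Equiv.refl G)
      ((Equiv.prodComm B (R × A)).trans (Equiv.prodAssoc R A B))
  have e₄ : (Matrix.of fun a (p : B × R × G) => T p.2.1 a p.1 p.2.2).rank = rA :=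
    Matrix.rank_submatrix (Matrix.of fun a (p : R × B × G) => T p.1 a p.2.1 p.2.2) (Equiv.refl A)
      ((Equiv.prodAssoc B R G).symm.trans
        (((Equiv.prodComm B R).prodCongr (Equiv.refl G)).trans (Equiv.prodAssoc R B G)))
  have hrA0 : 0 < rA := by
    rw [Nat.pos_iff_ne_zero]
    intro h0
    obtain ⟨r, a, b, g, h⟩ := hT
    classical
    have hbot := LinearMap.range_eq_bot.mp (Submodule.finrank_eq_zero.mp h0)
    have := congrFun (LinearMap.congr_fun hbot (Pi.single (r, b, g) 1)) a
    simp only [Matrix.mulVecLin_apply, Matrix.mulVec_single_one, LinearMap.zero_apply,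
      Pi.zero_apply, Matrix.col_apply, Matrix.of_apply] at this
    exact h this
  have h₁ : Fintype.card R * rA ≤ Fintype.card B * rG := by
    rw [← e₃]
    exact hA₁.trans (e₁.trans_le hA₂)
  have h₂ : Fintype.card R * rG ≤ Fintype.card B * rA := by
    rw [← e₄]
    exact hG₁.trans (e₂.trans_le hG₂)
  -- `h₁` and `h₂` add up to |R|(rA + rG) ≤ |B|(rA + rG), and rA + rG > 0.
  by_contra! hlt
  nlinarith [Nat.zero_le rG, mul_pos (Nat.sub_pos_of_lt hlt) hrA0]

/-! ### Kraus families, vanishing and reversible maps -/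

theorem exists_eq_star_mul_self {A : Type*} [NonUnitalCStarAlgebra A] [PartialOrder A]
    [StarOrderedRing A] {a : A} (ha : 0 ≤ a) : ∃ b, a = star b * b :=
  CStarAlgebra.nonneg_iff_eq_star_mul_self.mp ha

/-- The Kraus decomposition of a completely positive map. -/
theorem CompletelyPositiveMap.exists_kraus {d e : Type*} [Fintype d] [DecidableEq d] [Fintype e]
    [DecidableEq e] (φ : CompletelyPositiveMap (Matrix d d ℂ) (Matrix e e ℂ)) :
    ∃ T : d → e → d × e → ℂ, ∀ r r' x x',
      φ.toLinearMap (Matrix.single r r' 1) x x' = ∑ f, T r x f * star (T r' x' f) := by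
  rcases isEmpty_or_nonempty d with hd | ⟨⟨r₀⟩⟩
  · exact ⟨fun r => hd.elim r, fun r => hd.elim r⟩
  -- `M.map φ` is the Choi matrix; `M` is positive because E_rr' = (E_r₀r)* E_r₀r'. The rows of a
  -- square root of the Choi matrix give the Kraus family.
  let M : CStarMatrix d d (Matrix d d ℂ) := CStarMatrix.ofMatrix fun r r' => Matrix.single r r' 1
  let c : CStarMatrix d d (Matrix d d ℂ) :=
    CStarMatrix.ofMatrix fun s r => if s = r₀ then Matrix.single r₀ r 1 else 0
  have hc : ∀ s r, c s r = if s = r₀ then Matrix.single r₀ r 1 else 0 := fun _ _ => rfl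
  have hM : M = star c * c := by
    refine CStarMatrix.ext fun r r' => ?_
    rw [CStarMatrix.mul_apply, Finset.sum_eq_single r₀]
    · simp only [CStarMatrix.star_apply, hc, if_true, Matrix.star_eq_conjTranspose,
        Matrix.conjTranspose_single, star_one, Matrix.single_mul_single_same, mul_one]
      rfl
    · intro s _ hs
      simp only [CStarMatrix.star_apply, hc, if_neg hs, star_zero, zero_mul]
    · simp
  have hpos : 0 ≤ M.map φ := φ.map_cstarMatrix_nonneg M (hM ▸ star_mul_self_nonneg c)
  obtain ⟨k, hk⟩ := exists_eq_star_mul_self hpos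
  refine ⟨fun r x f => star (k f.1 r f.2 x), fun r r' x x' => ?_⟩
  have h := congrFun (congrFun (congrFun (congrFun hk r) r') x) x'
  rw [CStarMatrix.mul_apply] at h
  refine h.trans ?_
  simp [CStarMatrix.star_apply, Matrix.sum_apply, Matrix.mul_apply, Fintype.sum_prod_type,
    Matrix.star_apply]

/-- The density operators span all operators. -/
theorem LinearMap.eq_of_eqOn_densityOperators {d V : Type*} [Fintype d] [DecidableEq d]
    [AddCommGroup V] [Module ℂ V] {f g : Matrix d d ℂ →ₗ[ℂ] V}
    (h : Set.EqOn f g (densityOperators d)) : f = g := by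
  refine LinearMap.ext_on (s := {a : Matrix d d ℂ | 0 ≤ a}) CStarAlgebra.span_nonneg ?_
  intro P hP
  have hP' : P.PosSemidef := Matrix.nonneg_iff_posSemidef.mp hP
  by_cases ht : P.trace = 0
  · rw [hP'.trace_eq_zero_iff.mp ht, map_zero, map_zero]
  · have hmem : P.trace⁻¹ • P ∈ densityOperators d :=
      ⟨hP'.smul (inv_nonneg.mpr hP'.trace_nonneg), by
        rw [Matrix.trace_smul, smul_eq_mul, inv_mul_cancel₀ ht]⟩
    have := h hmem
    rw [map_smul, map_smul] at this
    exact smul_right_injective V (inv_ne_zero ht) this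

/-- A vanishing map annihilates the off-diagonal matrix units and does not distinguish the diagonal
ones. -/
theorem IsVanishing.apply_single {d e : Type*} [Fintype d] [DecidableEq d] [Fintype e]
    {E : Matrix d d ℂ →ₗ[ℂ] Matrix e e ℂ} (hE : IsVanishing E (densityOperators d)) :
    ∃ ρ : Matrix e e ℂ, ∀ r r', E (Matrix.single r r' 1) = if r = r' then ρ else 0 := by
  obtain ⟨ρ, -, hρ⟩ := hE
  have h : E = (Matrix.traceLinearMap d ℂ ℂ).smulRight ρ :=
    LinearMap.eq_of_eqOn_densityOperators fun A hA => by
      simp [hρ A hA, hA.2]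
  refine ⟨ρ, fun r r' => ?_⟩
  rw [h]
  by_cases hr : r = r'
  · subst hr
    simp
  · simp [hr]

/-- If a family of operators acts by conjugation as the identity channel, then all of its members
are scalar. -/
theorem exists_eq_scalar_of_sum_conj_eq_single {d m : Type*} [DecidableEq d] [Fintype m]
    (M : d → d → m → ℂ)
    (hM : ∀ r r' s s', ∑ j, M r s j * star (M r' s' j) = if r = s ∧ r' = s' then 1 else 0) :
    ∃ c : m → ℂ, ∀ r s j, M r s j = if r = s then c j else 0 := by
  rcases isEmpty_or_nonempty d with hd | ⟨⟨r₀⟩⟩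
  · exact ⟨0, fun r => hd.elim r⟩
  refine ⟨M r₀ r₀, fun r s j => ?_⟩
  split_ifs with hrs
  · subst hrs
    -- The squared norm expands to 1 - 1 - 1 + 1.
    have h0 : (M r r - M r₀ r₀) ⬝ᵥ star (M r r - M r₀ r₀) = 0 := by
      simp only [dotProduct, Pi.sub_apply, Pi.star_apply, star_sub, mul_sub, sub_mul,
        Finset.sum_sub_distrib, hM]
      simp
    exact sub_eq_zero.mp (congrFun (dotProduct_self_star_eq_zero.mp h0) j)
  · have h0 : M r s ⬝ᵥ star (M r s) = 0 := by
      simpa only [dotProduct, Pi.star_apply, hrs, false_and, if_false] using hM r r s s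
    exact congrFun (dotProduct_self_star_eq_zero.mp h0) j

theorem sum_sum_mul_sum {X J : Type*} [Fintype X] [Fintype J] (a b : X → J → ℂ) :
    ∑ j, (∑ x, a x j) * ∑ x', b x' j = ∑ x, ∑ x', ∑ j, a x j * b x' j := by
  simp only [Finset.sum_mul_sum]
  rw [Finset.sum_comm]
  exact Finset.sum_congr rfl fun x _ => Finset.sum_comm

/-- The environment of a reversible channel is decoupled from its input. -/
theorem IsReversible.exists_environment {d e G : Type*} [Fintype d] [DecidableEq d] [Fintype e]
    [DecidableEq e] [Fintype G] {E : Matrix d d ℂ →ₗ[ℂ] Matrix e e ℂ}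
    (hE : IsReversible E (densityOperators d)) (T : d → e → G → ℂ)
    (hT : ∀ r r' x x', E (Matrix.single r r' 1) x x' = ∑ g, T r x g * star (T r' x' g)) :
    ∃ lam : Matrix G G ℂ, ∀ r r' g g',
      ∑ x, T r x g * star (T r' x g') = if r = r' then lam g g' else 0 := by
  obtain ⟨R, hR⟩ := hE
  obtain ⟨S, hS⟩ := R.toCompletelyPositiveMap.exists_kraus
  have hid : R.toLinearMap ∘ₗ E = LinearMap.id :=
    LinearMap.eq_of_eqOn_densityOperators fun A hA => hR A hA
  have hRA : ∀ A s s', R.toLinearMap A s s' =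
      ∑ x, ∑ x', A x x' * ∑ h, S x s h * star (S x' s' h) := by
    intro A s s'
    conv_lhs => rw [Matrix.matrix_eq_sum_single A]
    simp only [map_sum, Matrix.sum_apply]
    refine Finset.sum_congr rfl fun x _ => Finset.sum_congr rfl fun x' _ => ?_
    have : Matrix.single x x' (A x x') = A x x' • Matrix.single x x' (1 : ℂ) := by simp
    rw [this, map_smul, Matrix.smul_apply, hS, smul_eq_mul]
  have htr : ∀ x x', ∑ s, ∑ h, S x s h * star (S x' s h) = if x = x' then 1 else 0 := by
    intro x x'
    have := R.trace_map' (Matrix.single x x' 1)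
    simp only [Matrix.trace, Matrix.diag_apply, hS] at this
    rw [this]
    by_cases hx : x = x'
    · subst hx
      rw [if_pos rfl]
      exact Matrix.trace_single_eq_same x (1 : ℂ)
    · rw [if_neg hx]
      exact Matrix.trace_single_eq_of_ne x x' (1 : ℂ) hx
  -- The products of Kraus operators of `R` and `E` form a Kraus family of the identity, so each is
  -- a scalar `c`. Inserting the trace condition `htr` then expresses the environment through these
  -- products.
  obtain ⟨c, hc⟩ := exists_eq_scalar_of_sum_conj_eq_single
    (fun r s (j : G × (e × d)) => ∑ x, T r x j.1 * S x s j.2) (by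
      intro r r' s s'
      have h := congrFun (congrFun (LinearMap.congr_fun hid (Matrix.single r r' 1)) s) s'
      rw [LinearMap.comp_apply, hRA, LinearMap.id_apply, Matrix.single_apply] at h
      rw [← h]
      simp only [star_sum]
      refine (sum_sum_mul_sum _ _).trans
        (Finset.sum_congr rfl fun x _ => Finset.sum_congr rfl fun x' _ => ?_)
      rw [hT, Finset.sum_mul_sum, Fintype.sum_prod_type]
      refine Finset.sum_congr rfl fun g _ => Finset.sum_congr rfl fun h _ => ?_
      rw [star_mul']
      ring)
  refine ⟨fun g g' => ∑ h, c (g, h) * star (c (g', h)), fun r r' g g' => ?_⟩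
  calc ∑ x, T r x g * star (T r' x g')
      = ∑ x, ∑ x', T r x g * star (T r' x' g') * ∑ s, ∑ h, S x s h * star (S x' s h) := by
        simp only [htr, mul_ite, mul_one, mul_zero, Finset.sum_ite_eq, Finset.mem_univ, if_true]
    _ = ∑ s, ∑ h, (∑ x, T r x g * S x s h) * star (∑ x, T r' x g' * S x s h) := by
        symm
        rw [← Fintype.sum_prod_type']
        simp only [star_sum]
        refine (sum_sum_mul_sum _ _).trans
          (Finset.sum_congr rfl fun x _ => Finset.sum_congr rfl fun x' _ => ?_)
        rw [← Fintype.sum_prod_type', Finset.mul_sum]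
        refine Finset.sum_congr rfl fun q _ => ?_
        rw [star_mul']
        ring
    _ = _ := by
        have : ∀ r s g h, ∑ x, T r x g * S x s h = if r = s then c (g, h) else 0 :=
          fun r s g h => hc r s (g, h)
        simp only [this]
        rw [Finset.sum_eq_single r]
        · by_cases hr : r = r'
          · simp [hr]
          · simp [hr, Ne.symm hr]
        · intro s _ hs
          simp [hs.symm]
        · simp

/-! ### Splitting indices and cyclic windows -/

/-- Choice functions on the complement of `X`, split along `Y`. -/
def piComplEquivProd {n : ℕ} (ι : Fin n → Type*) {X Y : Finset (Fin n)} (h : Disjoint X Y) :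
    (∀ i : {i // i ∉ X}, ι i) ≃ (∀ i : {i // i ∈ Y}, ι i) × (∀ i : {i // i ∉ X ∪ Y}, ι i) where
  toFun z := (fun i => z ⟨i, Finset.disjoint_right.mp h i.2⟩,
    fun i => z ⟨i, fun hi => i.2 (Finset.mem_union_left Y hi)⟩)
  invFun p i := if hi : (i : Fin n) ∈ Y then p.1 ⟨i, hi⟩ else
    p.2 ⟨i, fun hu => (Finset.mem_union.mp hu).elim i.2 hi⟩
  left_inv z := by
    funext i
    by_cases hi : (i : Fin n) ∈ Y <;> simp [hi]
  right_inv p := by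
    refine Prod.ext (funext fun i => ?_) (funext fun i => ?_)
    · simp [i.2]
    · have : (i : Fin n) ∉ Y := fun hi => i.2 (Finset.mem_union_right X hi)
      simp [this]

/-- Choice functions on a disjoint union as pairs of choice functions. -/
def piUnionEquivProd {n : ℕ} (ι : Fin n → Type*) {X Y : Finset (Fin n)} (h : Disjoint X Y) :
    (∀ i : {i // i ∈ X ∪ Y}, ι i) ≃ (∀ i : {i // i ∈ X}, ι i) × (∀ i : {i // i ∈ Y}, ι i) where
  toFun z := (fun i => z ⟨i, Finset.mem_union_left Y i.2⟩,
    fun i => z ⟨i, Finset.mem_union_right X i.2⟩)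
  invFun p i := if hi : (i : Fin n) ∈ X then p.1 ⟨i, hi⟩ else
    p.2 ⟨i, (Finset.mem_union.mp i.2).resolve_left hi⟩
  left_inv z := by
    funext i
    by_cases hi : (i : Fin n) ∈ X <;> simp [hi]
  right_inv p := by
    refine Prod.ext (funext fun i => ?_) (funext fun i => ?_)
    · simp [i.2]
    · simp [Finset.disjoint_right.mp h i.2]

/-- Makes the marginals on `X` and on `X ∪ Y` contractions of one and the same tensor. -/
theorem piEquivPiSubtypeProd_symm_piComplEquivProd_symm {n : ℕ} (ι : Fin n → Type*)
    {X Y : Finset (Fin n)} (h : Disjoint X Y) (a : ∀ i : {i // i ∈ X}, ι i)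
    (b : ∀ i : {i // i ∈ Y}, ι i) (c : ∀ i : {i // i ∉ X ∪ Y}, ι i) :
    (Equiv.piEquivPiSubtypeProd (fun i => i ∈ X) ι).symm (a, (piComplEquivProd ι h).symm (b, c)) =
      (Equiv.piEquivPiSubtypeProd (fun i => i ∈ X ∪ Y) ι).symm
        ((piUnionEquivProd ι h).symm (a, b), c) := by
  funext i
  by_cases hX : i ∈ X <;> by_cases hY : i ∈ Y <;>
    simp [Equiv.piEquivPiSubtypeProd, piComplEquivProd, piUnionEquivProd, hX, hY]

/-- Summing over the cyclic shifts of `{0, …, L - 1}`. -/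
theorem Fin.sum_sum_cyclic {n L : ℕ} [NeZero n] (f : Fin n → ℝ) (hL : L ≤ n) :
    ∃ Y : Fin n → Finset (Fin n), (∀ j, (Y j).card = L) ∧
      ∑ j, ∑ i ∈ Y j, f i = L * ∑ i, f i := by
  refine ⟨fun j => (Finset.univ.map (Fin.castLEEmb hL)).map (Equiv.addRight j).toEmbedding,
    fun j => by simp, ?_⟩
  simp only [Finset.sum_map]
  rw [Finset.sum_comm]
  -- Addition in `Fin n` wraps around, so translation permutes the indices.
  have : ∀ i : Fin L, ∑ j, f (Fin.castLE hL i + j) = ∑ j, f j :=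
    fun i => Equiv.sum_comp (Equiv.addLeft (Fin.castLE hL i)) f
  simp [this]

/-! ### Shares of a scheme -/

namespace QuantumOperation

/-- Relabelling the basis of the input of a quantum operation. -/
noncomputable def compReindex {d e e' : Type*} [Fintype d] [DecidableEq d] [Fintype e] [DecidableEq e]
    [Fintype e'] [DecidableEq e'] (R : QuantumOperation e d) (f : e' ≃ e) :
    QuantumOperation e' d where
  toLinearMap := R.toLinearMap ∘ₗ (Matrix.reindexAlgEquiv ℂ ℂ f).toLinearMap
  map_cstarMatrix_nonneg' k M hM := by
    -- Relabelling is a star homomorphism, hence completely positive.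
    let φ : Matrix e' e' ℂ →⋆ₐ[ℂ] Matrix e e ℂ :=
      { (Matrix.reindexAlgEquiv ℂ ℂ f).toAlgHom with
        map_star' := fun A => (Matrix.conjTranspose_reindex f f A).symm }
    exact R.map_cstarMatrix_nonneg' k (M.map φ)
      (CompletelyPositiveMapClass.map_cstarMatrix_nonneg' φ k M hM)
  trace_map' A := by
    rw [LinearMap.comp_apply, R.trace_map']
    exact Equiv.sum_comp f.symm fun i => A i i

variable {n : ℕ} {d : Type*} [Fintype d] [DecidableEq d]
  {ι : Fin n → Type*} [∀ i, Fintype (ι i)] [∀ i, DecidableEq (ι i)]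
  {W : QuantumOperation d (∀ i, ι i)} {X Y : Finset (Fin n)}

theorem onShares_apply (W : QuantumOperation d (∀ i, ι i)) (X : Finset (Fin n))
    (A : Matrix d d ℂ) (x x' : ∀ i : {i // i ∈ X}, ι i) :
    W.onShares X A x x' = ∑ z : (∀ i : {i // i ∉ X}, ι i),
      W.toLinearMap A ((Equiv.piEquivPiSubtypeProd (fun i => i ∈ X) ι).symm (x, z))
        ((Equiv.piEquivPiSubtypeProd (fun i => i ∈ X) ι).symm (x', z)) :=
  rfl

theorem IsQSSScheme.isQualified_univ (hW : W.IsQSSScheme) : W.IsQualified Finset.univ := by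
  obtain ⟨R, hR⟩ := hW
  let f : (∀ i : {i // i ∈ (Finset.univ : Finset (Fin n))}, ι i) ≃ ∀ i, ι i :=
    { toFun := fun x i => x ⟨i, Finset.mem_univ i⟩
      invFun := fun x i => x i
      left_inv := fun _ => rfl
      right_inv := fun _ => rfl }
  refine ⟨R.compReindex f, fun ρ hρ => ?_⟩
  have h : Matrix.reindexAlgEquiv ℂ ℂ f (W.onShares Finset.univ ρ) = W.toLinearMap ρ := by
    ext x x'
    have hemp : IsEmpty {i // i ∉ (Finset.univ : Finset (Fin n))} :=
      ⟨fun i => i.2 (Finset.mem_univ _)⟩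
    rw [Matrix.coe_reindexAlgEquiv, Matrix.reindex_apply, Matrix.submatrix_apply, onShares_apply,
      Fintype.sum_unique]
    have hglue : ∀ (y : ∀ i, ι i) z,
        (Equiv.piEquivPiSubtypeProd (fun i => i ∈ (Finset.univ : Finset (Fin n))) ι).symm
          (f.symm y, z) = y := by
      intro y z
      funext i
      simp [f, Equiv.piEquivPiSubtypeProd]
    rw [hglue, hglue]
  exact (congrArg R.toLinearMap h).trans (hR ρ hρ)

/-- Tracing out everything leaves the scalar Tr ρ = 1. In a ramp scheme this forces `L ≤ k`. -/
theorem isForbidden_empty (W : QuantumOperation d (∀ i, ι i)) : W.IsForbidden ∅ := by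
  refine ⟨1, ⟨Matrix.PosSemidef.one, by simp⟩, fun ρ hρ => ?_⟩
  ext x x'
  have hemp : IsEmpty {i // i ∈ (∅ : Finset (Fin n))} := ⟨fun i => Finset.notMem_empty _ i.2⟩
  obtain rfl : x = x' := Subsingleton.elim _ _
  rw [Matrix.one_apply_eq, onShares_apply, ← hρ.2, ← W.trace_map' ρ, Matrix.trace,
    ← Equiv.sum_comp (Equiv.piEquivPiSubtypeProd (fun i => i ∈ (∅ : Finset (Fin n))) ι).symm,
    Fintype.sum_prod_type,
    Fintype.sum_unique fun x : ∀ i : {i // i ∈ (∅ : Finset (Fin n))}, ι i => ∑ z, _]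
  obtain rfl : x = default := Subsingleton.elim _ _
  rfl

theorem nonempty_share [Nonempty d] (W : QuantumOperation d (∀ i, ι i)) (i : Fin n) :
    Nonempty (ι i) := by
  by_contra h
  have : IsEmpty (∀ i, ι i) := ⟨fun x => h ⟨x i⟩⟩
  obtain ⟨r⟩ := ‹Nonempty d›
  have := W.trace_map' (Matrix.single r r 1)
  simp [Matrix.trace_single_eq_same, Matrix.trace_eq_zero_of_isEmpty] at this

/-- Shares that turn a forbidden set into a qualified one are at least as large as the secret. -/
theorem IsForbidden.card_le_prod_card [Nonempty d] (hX : W.IsForbidden X)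
    (hXY : Disjoint X Y) (hU : W.IsQualified (X ∪ Y)) :
    Fintype.card d ≤ ∏ i ∈ Y, Fintype.card (ι i) := by
  obtain ⟨T, hT⟩ := W.toCompletelyPositiveMap.exists_kraus
  let j := Equiv.piEquivPiSubtypeProd (fun i => i ∈ X ∪ Y) ι
  obtain ⟨rho, hrho⟩ := hX.apply_single
  -- The discarded shares join the Kraus index as the environment of `X ∪ Y`.
  obtain ⟨lam, hlam⟩ := IsReversible.exists_environment hU
    (fun r u (g : (∀ i : {i // i ∉ X ∪ Y}, ι i) × (d × ∀ i, ι i)) =>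
      T r (j.symm (u, g.1)) g.2)
    (fun r r' x x' => by simp only [onShares_apply, hT, Fintype.sum_prod_type, j])
  have hcard := card_le_card_of_decoupled
    (fun r a b (g : (∀ i : {i // i ∉ X ∪ Y}, ι i) × (d × ∀ i, ι i)) =>
      T r (j.symm ((piUnionEquivProd ι hXY).symm (a, b), g.1)) g.2) rho lam ?_ ?_ ?_
  · rwa [Fintype.card_pi, Finset.prod_coe_sort Y fun i => Fintype.card (ι i)] at hcard
  · intro r r' a a'
    have h : W.onShares X (Matrix.single r r' 1) a a' = if r = r' then rho a a' else 0 := by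
      rw [hrho]
      split_ifs <;> rfl
    rw [← h, onShares_apply, ← Equiv.sum_comp (piComplEquivProd ι hXY).symm, Fintype.sum_prod_type]
    simp only [Fintype.sum_prod_type, piEquivPiSubtypeProd_symm_piComplEquivProd_symm, hT, j]
  · intro r r' g g'
    rw [← hlam r r' g g', ← Equiv.sum_comp (piUnionEquivProd ι hXY).symm]
    simp only [Fintype.sum_prod_type]
  · by_contra! h0
    have hT0 : ∀ r x f, T r x f = 0 := by
      intro r x f
      have := h0 r (piUnionEquivProd ι hXY (j x).1).1 (piUnionEquivProd ι hXY (j x).1).2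
        ((j x).2, f)
      simpa using this
    obtain ⟨r⟩ := ‹Nonempty d›
    have := W.trace_map' (Matrix.single r r 1)
    simp [Matrix.trace, hT, hT0] at this

end QuantumOperation

theorem corollary2 {n : ℕ} {d : Type*} [Fintype d] [DecidableEq d] [Nonempty d]
    {ι : Fin n → Type*} [∀ i, Fintype (ι i)] [∀ i, DecidableEq (ι i)]
    (k L : ℕ) (hL : 1 ≤ L)
    (W : QuantumOperation d (∀ i, ι i)) (hW : W.IsThresholdRampScheme k L) :
    (1 / (L : ℝ)) * Real.log (Module.finrank ℂ (EuclideanSpace ℂ d)) ≤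
      (1 / (n : ℝ)) * ∑ i : Fin n, Real.log (Module.finrank ℂ (EuclideanSpace ℂ (ι i))) := by
  simp only [finrank_euclideanSpace]
  have hLk : L ≤ k := by
    have := (hW.isForbidden_iff ∅).mp W.isForbidden_empty
    rw [Finset.card_empty] at this
    omega
  have hkn : k ≤ n := by
    simpa using (hW.isQualified_iff Finset.univ).mp hW.isQSSScheme.isQualified_univ
  have : NeZero n := ⟨by omega⟩
  have key : ∀ Y : Finset (Fin n), Y.card = L →
      Real.log (Fintype.card d) ≤ ∑ i ∈ Y, Real.log (Fintype.card (ι i)) := by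
    intro Y hY
    -- There is room for `X` outside `Y` because `k ≤ n`; then `X` is just forbidden and `X ∪ Y`
    -- just qualified.
    obtain ⟨X, hXY, hX⟩ := Finset.exists_subset_card_eq (s := Yᶜ) (n := k - L) (by
      rw [Finset.card_compl, Fintype.card_fin, hY]
      omega)
    have hdisj : Disjoint X Y := Finset.disjoint_left.mpr fun i hi => Finset.mem_compl.mp (hXY hi)
    have hle := QuantumOperation.IsForbidden.card_le_prod_card
      ((hW.isForbidden_iff X).mpr (by omega)) hdisj
      ((hW.isQualified_iff (X ∪ Y)).mpr (by rw [Finset.card_union_of_disjoint hdisj]; omega))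
    rw [← Real.log_prod fun i _ => by
      have := W.nonempty_share i
      exact_mod_cast Fintype.card_ne_zero]
    exact Real.log_le_log (by exact_mod_cast Fintype.card_pos) (by exact_mod_cast hle)
  obtain ⟨Y, hY, hsum⟩ := Fin.sum_sum_cyclic
    (fun i : Fin n => Real.log (Fintype.card (ι i))) (hLk.trans hkn)
  have h : (n : ℝ) * Real.log (Fintype.card d) ≤ L * ∑ i, Real.log (Fintype.card (ι i)) := by
    rw [← hsum]
    simpa using Finset.sum_le_sum fun (j : Fin n) (_ : j ∈ Finset.univ) => key (Y j) (hY j)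
  have hn0 : (0 : ℝ) < n := by exact_mod_cast Nat.pos_of_neZero n
  have hL0 : (0 : ℝ) < L := by exact_mod_cast hL
  rw [one_div_mul_eq_div, one_div_mul_eq_div, div_le_div_iff₀ hL0 hn0]
  linarith
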